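/- **Corollary 1.2 (finite Euler products explicit formula).** Let $\mathbb N=\{1,2,3,\dots\}$. Let $c_q(a)=\sum_{1\le j\le q,\ (j,q)=1}\cos(2\pi ja/q)$ denote the Ramanujan sum, and let $v_p(a)$ be the $p$-adic valuation. Call $f:\mathbb N\to\mathbb C$ *multiplicative* if $f(mn)=f(m)f(n)$ for all coprime $m,n$ (the null function is allowed). Let $G:\mathbb N\to\mathbb C$ be a multiplicative *Ramanujan coefficient*, i.e. assume that the series $R_G(a)=\sum_{q=1}^{\infty}G(q)c_q(a)$ (the limit of its partial sums over $q\le x$ as $x\to\infty$) converges for every $a\in\mathbb N$. For a prime $p$ put $w_{p,G}=\max\{w\ge1: G(p^k)=G(p)^k \text{ for all } 1\le k\le w\}$ (with $w_{p,G}=\infty$ if there is no maximum) and $v_{p,G}=\min\{K\ge 0: G(p^{K+1})\ne1\}$ (with $v_{p,G}=\infty$ if there is no such $K$). The prime $p$ is *bad* if $1\le|G(p)|\le p$. It is *transparent* if $G(p)=1$; a transparent prime is *hypertransparent* if $w_{p,G}=\infty$ and *simply transparent* if $w_{p,G}\neq\infty$. The *transparency conductor* is $N_T=N_T(G)=\prod_{p\text{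 simply transparent}}p^{w_{p,G}}$ if there are finitely many bad primes, and $N_T(G)=0$ otherwise. Then the following hold. 1. $N_T\ge1$, and $R_G(a)=0$ for every $a\in\mathbb N$ not divisible by $N_T$. 2. There is a multiplicative function $M_G:\mathbb N\to\mathbb C$ such that, for all $a\in\mathbb N$, $$R_G(aN_T)=R_G(N_T)\,M_G(a)=R_G(N_T)\prod_{p\mid a}M_G(p^{v_p(a)}),$$ with the following values for all primes $p$ and integers $K\ge0$: if $p$ is hypertransparent, $M_G(p^K)=1+p+\dots+p^K$; if $p$ is simply transparent, $$M_G(p^K)=\bigl(1-G(p^{v_{p,G}+1})\bigr)^{-1}\sum_{k=0}^{K}p^k\bigl(G(p^{v_{p,G}+k})-G(p^{v_{p,G}+k+1})\bigr);$$ otherwise $$M_G(p^K)=(1-G(p))^{-1}\sum_{k=0}^{K}p^k\bigl(G(p^k)-G(p^{k+1})\bigr).$$ If $R_G(N_T)\ne0$, then $M_G$ is the only function $M:\mathbb N\to\mathbb C$ with $R_G(aN_T)=R_G(N_T)M(a)$ for all $a\in\mathbb N$. 3. If $R_G(N_T)=0$, then $R_G$ is identically $0$. 4. For all $a\in\mathbb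 N$, $$R_G(a)=R_G(N_T)\prod_{v_{p,G}=\infty}\Bigl(\sum_{v=0}^{v_p(a)}p^v\Bigr)\prod_{v_{p,G}\ne\infty}\Bigl(\sum_{v=0}^{v_p(a)}p^{\,v-v_{p,G}}\,\frac{G(p^v)-G(p^{v+1})}{1-G(p^{v_{p,G}+1})}\Bigr).$$ For each $a$, all but finitely many primes satisfy $v_{p,G}=v_p(a)=0$; if $G$ is not the null function, all but finitely many factors of both products equal $1$. (If $G$ is the null function, then $R_G(N_T)=0$ and the right-hand side is understood to be $0$.) 5. $R_G$ is *semi-multiplicative*: there are $c\in\mathbb C\setminus\{0\}$, $t\in\mathbb N$ and a multiplicative $M$ such that, for all $n\in\mathbb N$, $R_G(n)=cM(n/t)$ if $t\mid n$ and $R_G(n)=0$ if $t\nmid n$. It is also *Selberg-multiplicative*: there are functions $f_p:\{0,1,2,\dots\}\to\mathbb C$, one for each prime $p$, with $f_p(0)=1$ for all but finitely many $p$, such that $R_G(a)=\prod_p f_p(v_p(a))$ for all $a\in\mathbb N$. If $R_G(N_T)\neq0$, then $N_T=\min\{n\in\mathbb N:R_G(n)\ne0\}$ and, for all $a\in\mathbb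 N$, $$R_G(a)=R_G(N_T)\prod_{p}\frac{R_G\bigl(N_T\,p^{v_p(a)-v_p(N_T)}\bigr)}{R_G(N_T)},$$ where all but finitely many factors equal $1$. -/

import Mathlib

open Filter Topology

namespace RamanujanExpansion

noncomputable section

/- Arithmetic functions `f : {1, 2, 3, …} → ℂ` are Mathlib's `ArithmeticFunction ℂ`
(functions on `ℕ` normalised by `f 0 = 0`). -/

/-- Multiplicative arithmetic functions; unlike `ArithmeticFunction.IsMultiplicative`, the null
function is included. -/
def IsMult (f : ArithmeticFunction ℂ) : Prop :=
  ∀ m n : ℕ, m.Coprime n → f (m * n) = f m * f n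

/-- The Ramanujan sum `c_q(a)`, the sum of `cos (2 π j a / q)` over `1 ≤ j ≤ q`, `(j, q) = 1`. -/
def ramanujanSum (q a : ℕ) : ℝ :=
  ∑ j ∈ (Finset.Icc 1 q).filter (fun j => j.Coprime q), Real.cos (2 * Real.pi * j * a / q)

/-- The partial sum over `1 ≤ q ≤ x` of the Ramanujan series of coefficient `G` at `a`. -/
def ramanujanPartial (G : ArithmeticFunction ℂ) (a x : ℕ) : ℂ :=
  ∑ q ∈ Finset.Icc 1 x, G q * (ramanujanSum q a : ℂ)

/-- `G` is a Ramanujan coefficient: its Ramanujan series converges (possibly only conditionally,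
in the natural order of summation) at every natural number `a ≥ 1`. -/
def IsRamanujanCoefficient (G : ArithmeticFunction ℂ) : Prop :=
  ∀ a : ℕ, a ≠ 0 → ∃ l : ℂ, Tendsto (ramanujanPartial G a) atTop (𝓝 l)

/-- The sum `R_G` of the Ramanujan series of `G`, as an arithmetic function. -/
def ramanujanSeries (G : ArithmeticFunction ℂ) : ArithmeticFunction ℂ :=
  ⟨fun a => if a = 0 then 0 else limUnder atTop (ramanujanPartial G a), by simp⟩

/-- The completely multiplicative index `w_{p,G}`, the largest `w ≥ 1` with `G(p^k) = G(p)^k` for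
all `1 ≤ k ≤ w`, and `∞` if there is no largest one. -/
def cmIndex (G : ArithmeticFunction ℂ) (p : ℕ) : ℕ∞ :=
  ⨆ (w : ℕ) (_ : 1 ≤ w ∧ ∀ k, 1 ≤ k → k ≤ w → G (p ^ k) = G p ^ k), (w : ℕ∞)

/-- The transparency index `v_{p,G}`, the least `K ≥ 0` with `G(p^(K+1)) ≠ 1`, and `∞` if there is
no such `K`. -/
def transparencyIndex (G : ArithmeticFunction ℂ) (p : ℕ) : ℕ∞ :=
  ⨅ (K : ℕ) (_ : G (p ^ (K + 1)) ≠ 1), (K : ℕ∞)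

def IsBadPrime (G : ArithmeticFunction ℂ) (p : ℕ) : Prop :=
  p.Prime ∧ 1 ≤ ‖G p‖ ∧ ‖G p‖ ≤ p

def IsTransparentPrime (G : ArithmeticFunction ℂ) (p : ℕ) : Prop :=
  p.Prime ∧ G p = 1

def IsSimplyTransparent (G : ArithmeticFunction ℂ) (p : ℕ) : Prop :=
  IsTransparentPrime G p ∧ cmIndex G p ≠ ⊤

def IsHypertransparent (G : ArithmeticFunction ℂ) (p : ℕ) : Prop :=
  IsTransparentPrime G p ∧ cmIndex G p = ⊤

open Classical in
/-- The transparency conductor `N_T(G)`: the product of `p ^ w_{p,G}` over the simply transparent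
primes `p`, if `G` has finitely many bad primes, and `0` otherwise. -/
def transparencyConductor (G : ArithmeticFunction ℂ) : ℕ :=
  if {p : ℕ | IsBadPrime G p}.Finite then
    ∏ᶠ (p : ℕ) (_ : IsSimplyTransparent G p), p ^ (cmIndex G p).toNat
  else 0

/-- The Euler factor at a prime `p` with `v_{p,G} = ∞` of the product for `R_G`, with `v = v_p(a)`. -/
def hyperFactor (p v : ℕ) : ℂ :=
  ∑ k ∈ Finset.range (v + 1), (p : ℂ) ^ k

/-- The Euler factor at a prime `p` with `v_{p,G} ≠ ∞` of the product for `R_G`, with `v = v_p(a)`. -/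
def finiteFactor (G : ArithmeticFunction ℂ) (p v : ℕ) : ℂ :=
  ∑ k ∈ Finset.range (v + 1),
    (p : ℂ) ^ ((k : ℤ) - ((transparencyIndex G p).toNat : ℤ)) *
      ((G (p ^ k) - G (p ^ (k + 1))) / (1 - G (p ^ ((transparencyIndex G p).toNat + 1))))

/-- Rearick's semi-multiplicative functions: `F(n) = c M(n / t)` with `c ≠ 0`, `t ≥ 1` and `M`
multiplicative, `M` being understood to vanish outside the natural numbers. -/
def IsSemiMultiplicative (F : ArithmeticFunction ℂ) : Prop :=
  ∃ (c : ℂ) (t : ℕ) (M : ArithmeticFunction ℂ), c ≠ 0 ∧ 0 < t ∧ IsMult M ∧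
    ∀ n : ℕ, n ≠ 0 → F n = if t ∣ n then c * M (n / t) else 0

/-- Selberg-multiplicative functions: `F(a)` is the product over all primes of `f_p(v_p(a))`, where
`f_p(0) = 1` for all but finitely many `p` (so that only finitely many factors differ from `1`). -/
def IsSelbergMultiplicative (F : ArithmeticFunction ℂ) : Prop :=
  ∃ f : Nat.Primes → ℕ → ℂ, {p | f p 0 ≠ 1}.Finite ∧
    ∀ a : ℕ, a ≠ 0 → F a = ∏ᶠ p : Nat.Primes, f p (a.factorization p)

end

end RamanujanExpansion

open RamanujanExpansion

namespace RamanujanExpansion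

/-! Everything is local. Fix a prime `p` and `b` prime to `p`, and let `C(x)` be the partial sum at
`b` over moduli prime to `p`. Since `c_{p^k}(p^v b)` is a difference of consecutive values of `p^k ·
1_{k ≤ v}`, Abel summation (`ramanujanPartial_prime_pow_mul`) writes the partial sum at `p^v b` as a
finite combination of the brackets `G(p^k) C(x/p^k) - G(p^(k+1)) C(x/p^(k+1))`. Convergence for
every `v` makes each bracket converge, say to `l k`; after rescaling it reads `G(p^k) C(x) -
G(p^(k+1)) C(x/p)`.

Now there is a dichotomy. If `G(p^k) = G(p)^k` for all `k`, the brackets are proportional and `l k =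
G(p)^k l 0`. Otherwise two of them are linearly independent in `C(x)` and `C(x/p)`, so `C` itself
converges to some `t` and `l k = t (G(p^k) - G(p^(k+1)))`. No absolute convergence is needed. In
both cases the dependence on `v` is a factor `eulerFactor`, normalised to be `1` at the transparency
index (at `0` if that index is infinite) and zero below it (`ramanujanSeries_prime_pow_mul`).

The terms of the series at `1` tend to zero, so only finitely many primes are transparent, and `N_T`
is the integer whose valuations are the normalising exponents. Changing the exponents of `a` into
those of `N_T` one prime at a time gives `R_G(a) = R_G(N_T) ∏ eulerFactor`
(`ramanujanSeries_eq_mul_prod`), from which all the claims follow. -/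

/-! ### Ramanujan sums -/

theorem sum_cos_eq (n a : ℕ) (hn : n ≠ 0) :
    ∑ j ∈ Finset.Icc 1 n, Real.cos (2 * Real.pi * j * a / n) = if n ∣ a then (n : ℝ) else 0 := by
  have hprim := Complex.isPrimitiveRoot_exp n hn
  set z : ℂ := Complex.exp (2 * Real.pi * Complex.I / n) with hz
  have hcos (j : ℕ) : Real.cos (2 * Real.pi * j * a / n) = ((z ^ a) ^ j).re := by
    rw [← pow_mul, hz, ← Complex.exp_nat_mul]
    have : ((a * j : ℕ) : ℂ) * (2 * Real.pi * Complex.I / n)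
        = ((2 * Real.pi * j * a / n : ℝ) : ℂ) * Complex.I := by
      push_cast; ring
    rw [this, Complex.exp_ofReal_mul_I_re]
  simp_rw [hcos]
  rw [← Complex.re_sum]
  have hz1 : (z ^ a) ^ n = 1 := by rw [← pow_mul, mul_comm, pow_mul, hprim.pow_eq_one, one_pow]
  have hsum : ∑ j ∈ Finset.Icc 1 n, (z ^ a) ^ j = z ^ a * ∑ j ∈ Finset.range n, (z ^ a) ^ j := by
    rw [← Finset.Ico_succ_right_eq_Icc, Finset.sum_Ico_eq_sum_range, Finset.mul_sum]
    simp [pow_add]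
  rw [hsum]
  split_ifs with h
  · rw [(hprim.pow_eq_one_iff_dvd a).2 h]; simp
  · have hne : z ^ a ≠ 1 := fun h' => h ((hprim.pow_eq_one_iff_dvd a).1 h')
    rw [geom_sum_eq hne, hz1]; simp

/-- Each fraction `j / n` in `(0, 1]` has a unique form in lowest terms, with denominator dividing
`n`. -/
theorem sum_divisors_sum_coprime (n : ℕ) (hn : n ≠ 0) (f : ℝ → ℝ) :
    ∑ d ∈ n.divisors, ∑ j ∈ (Finset.Icc 1 d).filter (fun j => j.Coprime d), f (j / d)
      = ∑ j ∈ Finset.Icc 1 n, f (j / n) := by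
  rw [Finset.sum_sigma']
  refine Finset.sum_bij' (fun x _ => x.2 * (n / x.1)) (fun j _ => ⟨n / j.gcd n, j / j.gcd n⟩)
    ?_ ?_ ?_ ?_ ?_
  · rintro ⟨d, j⟩ h
    simp only [Finset.mem_sigma, Nat.mem_divisors, Finset.mem_filter, Finset.mem_Icc] at h ⊢
    obtain ⟨⟨⟨e, rfl⟩, -⟩, ⟨h1, h2⟩, h3⟩ := h
    have hd : 0 < d := by omega
    have he : 0 < e := Nat.pos_of_ne_zero fun h => hn (by simp [h])
    rw [Nat.mul_div_cancel_left _ hd]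
    exact ⟨Nat.mul_pos h1 he, Nat.mul_le_mul_right _ h2⟩
  · intro j h
    simp only [Finset.mem_sigma, Nat.mem_divisors, Finset.mem_filter, Finset.mem_Icc] at h ⊢
    have hg : 0 < j.gcd n := Nat.gcd_pos_of_pos_left _ h.1
    exact ⟨⟨Nat.div_dvd_of_dvd (Nat.gcd_dvd_right _ _), hn⟩,
      ⟨Nat.div_pos (Nat.gcd_le_left _ h.1) hg, Nat.div_le_div_right h.2⟩,
      Nat.coprime_div_gcd_div_gcd hg⟩
  · rintro ⟨d, j⟩ h
    simp only [Finset.mem_sigma, Nat.mem_divisors, Finset.mem_filter, Finset.mem_Icc] at h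
    obtain ⟨⟨⟨e, rfl⟩, -⟩, ⟨h1, h2⟩, h3⟩ := h
    have hd : 0 < d := by omega
    have he : 0 < e := Nat.pos_of_ne_zero fun h => hn (by simp [h])
    have hg : (j * e).gcd (d * e) = e := by rw [Nat.gcd_mul_right, h3.gcd_eq_one, one_mul]
    simp only [Nat.mul_div_cancel_left _ hd, hg, Nat.mul_div_cancel _ he]
  · intro j h
    simp only [Finset.mem_Icc] at h
    have hg : 0 < j.gcd n := Nat.gcd_pos_of_pos_left _ h.1
    simp only
    rw [Nat.div_div_self (Nat.gcd_dvd_right _ _) hn, Nat.div_mul_cancel (Nat.gcd_dvd_left _ _)]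
  · rintro ⟨d, j⟩ h
    simp only [Finset.mem_sigma, Nat.mem_divisors, Finset.mem_filter, Finset.mem_Icc] at h
    obtain ⟨⟨⟨e, rfl⟩, -⟩, ⟨h1, h2⟩, h3⟩ := h
    have hd : 0 < d := by omega
    have he : 0 < e := Nat.pos_of_ne_zero fun h => hn (by simp [h])
    simp only [Nat.mul_div_cancel_left _ hd]
    push_cast
    rw [mul_div_mul_right _ _ (by positivity)]

theorem sum_divisors_ramanujanSum (n a : ℕ) (hn : n ≠ 0) :
    ∑ d ∈ n.divisors, ramanujanSum d a = if n ∣ a then (n : ℝ) else 0 := by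
  rw [← sum_cos_eq n a hn]
  have := sum_divisors_sum_coprime n hn (fun t => Real.cos (2 * Real.pi * a * t))
  convert this using 2
  · refine Finset.sum_congr rfl fun j _ => ?_
    congr 1; ring
  · congr 1; ring

/-- The arithmetic function `d ↦ d` supported on the divisors of `a`. -/
def divisorIndicator (a : ℕ) : ArithmeticFunction ℝ :=
  ⟨fun d => if d ∣ a then (d : ℝ) else 0, by simp⟩

theorem divisorIndicator_apply (a d : ℕ) :
    divisorIndicator a d = if d ∣ a then (d : ℝ) else 0 := rfl

theorem isMultiplicative_divisorIndicator (a : ℕ) : (divisorIndicator a).IsMultiplicative := by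
  refine ⟨by simp [divisorIndicator_apply], fun {m n} h => ?_⟩
  simp only [divisorIndicator_apply]
  have : m * n ∣ a ↔ m ∣ a ∧ n ∣ a :=
    ⟨fun h => ⟨dvd_of_mul_right_dvd h, dvd_of_mul_left_dvd h⟩,
      fun h' => h.mul_dvd_of_dvd_of_dvd h'.1 h'.2⟩
  by_cases h1 : m ∣ a <;> by_cases h2 : n ∣ a <;> simp [this, h1, h2]

/-- The Ramanujan sum as an arithmetic function of its modulus. -/
noncomputable def ramanujanFunction (a : ℕ) : ArithmeticFunction ℝ :=
  ⟨fun q => ramanujanSum q a, by simp [ramanujanSum]⟩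

theorem ramanujanFunction_apply (a q : ℕ) : ramanujanFunction a q = ramanujanSum q a := rfl

theorem ramanujanFunction_eq (a : ℕ) :
    ramanujanFunction a = (ArithmeticFunction.moebius : ArithmeticFunction ℝ) * divisorIndicator a := by
  have h : (ArithmeticFunction.zeta : ArithmeticFunction ℝ) * ramanujanFunction a = divisorIndicator a := by
    ext n
    rcases eq_or_ne n 0 with rfl | hn
    · simp
    rw [ArithmeticFunction.coe_zeta_mul_apply, divisorIndicator_apply]
    exact sum_divisors_ramanujanSum n a hn
  rw [← h, ← mul_assoc, ArithmeticFunction.coe_moebius_mul_coe_zeta, one_mul]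

theorem isMultiplicative_ramanujanFunction (a : ℕ) : (ramanujanFunction a).IsMultiplicative := by
  rw [ramanujanFunction_eq]
  exact ArithmeticFunction.isMultiplicative_moebius.intCast.mul (isMultiplicative_divisorIndicator a)

theorem ramanujanSum_mul {m n : ℕ} (h : m.Coprime n) (a : ℕ) :
    ramanujanSum (m * n) a = ramanujanSum m a * ramanujanSum n a :=
  (isMultiplicative_ramanujanFunction a).map_mul_of_coprime h

theorem ramanujanSum_one_left (a : ℕ) : ramanujanSum 1 a = 1 :=
  (isMultiplicative_ramanujanFunction a).map_one

/-- In the Möbius formula for `c_q`, the argument enters only through which divisors of `q` divide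
it. -/
theorem ramanujanSum_mul_right {q c : ℕ} (h : q.Coprime c) (b : ℕ) :
    ramanujanSum q (c * b) = ramanujanSum q b := by
  rw [← ramanujanFunction_apply, ← ramanujanFunction_apply, ramanujanFunction_eq,
    ramanujanFunction_eq, ArithmeticFunction.mul_apply, ArithmeticFunction.mul_apply]
  refine Finset.sum_congr rfl fun x hx => ?_
  have hx2 : x.2 ∣ q := ⟨x.1, by rw [mul_comm]; exact (Nat.mem_divisorsAntidiagonal.1 hx).1.symm⟩
  simp only [divisorIndicator_apply]
  simp only [(Nat.Coprime.coprime_dvd_left hx2 h).dvd_mul_left]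

theorem ramanujanSum_prime_pow_succ {p : ℕ} (hp : p.Prime) (k a : ℕ) :
    ramanujanSum (p ^ (k + 1)) a
      = (if p ^ (k + 1) ∣ a then (p : ℝ) ^ (k + 1) else 0) - if p ^ k ∣ a then (p : ℝ) ^ k else 0 := by
  have h1 := sum_divisors_ramanujanSum (p ^ (k + 1)) a (pow_ne_zero _ hp.ne_zero)
  have h0 := sum_divisors_ramanujanSum (p ^ k) a (pow_ne_zero _ hp.ne_zero)
  rw [Nat.sum_divisors_prime_pow hp] at h0 h1
  rw [Finset.sum_range_succ, h0] at h1
  push_cast at h1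
  linarith

/-! ### Splitting off one prime -/

theorem tendsto_ramanujanPartial {G : ArithmeticFunction ℂ} (hR : IsRamanujanCoefficient G)
    {a : ℕ} (ha : a ≠ 0) :
    Tendsto (ramanujanPartial G a) atTop (𝓝 (ramanujanSeries G a)) := by
  have : ramanujanSeries G a = limUnder atTop (ramanujanPartial G a) := if_neg ha
  rw [this]
  exact tendsto_nhds_limUnder (hR a ha)

/-- Groups the moduli by their exact power of `p`. Any `N > x` suffices because `k < p ^ k`;
superfluous `k` give empty inner sums. -/
theorem sum_Icc_eq_sum_prime_pow_mul {p : ℕ} (hp : p.Prime) {x N : ℕ} (hN : x < N) (f : ℕ → ℂ) :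
    ∑ q ∈ Finset.Icc 1 x, f q = ∑ k ∈ Finset.range N,
      ∑ m ∈ (Finset.Icc 1 (x / p ^ k)).filter (fun m => ¬ p ∣ m), f (p ^ k * m) := by
  rw [Finset.sum_sigma']
  symm
  refine Finset.sum_bij' (fun y _ => p ^ y.1 * y.2)
    (fun q _ => ⟨q.factorization p, q / p ^ q.factorization p⟩) ?_ ?_ ?_ ?_ ?_
  · rintro ⟨k, m⟩ h
    simp only [Finset.mem_sigma, Finset.mem_range, Finset.mem_filter, Finset.mem_Icc] at h ⊢
    have hk : 0 < p ^ k := pow_pos hp.pos _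
    refine ⟨Nat.mul_pos hk h.2.1.1, ?_⟩
    rw [mul_comm]
    exact (Nat.le_div_iff_mul_le hk).1 h.2.1.2
  · intro q h
    simp only [Finset.mem_sigma, Finset.mem_range, Finset.mem_filter, Finset.mem_Icc] at h ⊢
    have hq : q ≠ 0 := by omega
    have h1 := Nat.ordProj_le p hq
    have h2 := Nat.lt_pow_self (n := q.factorization p) hp.one_lt
    exact ⟨by omega, ⟨Nat.ordCompl_pos p hq, Nat.div_le_div_right h.2⟩,
      Nat.not_dvd_ordCompl hp hq⟩
  · rintro ⟨k, m⟩ h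
    simp only [Finset.mem_sigma, Finset.mem_range, Finset.mem_filter, Finset.mem_Icc] at h
    have hm : m ≠ 0 := by omega
    have hf : (p ^ k * m).factorization p = k := by
      rw [Nat.factorization_mul (pow_ne_zero _ hp.ne_zero) hm, Finsupp.add_apply,
        hp.factorization_pow, Finsupp.single_eq_same,
        Nat.factorization_eq_zero_of_not_dvd h.2.2, add_zero]
    simp only [hf, Nat.mul_div_cancel_left _ (pow_pos hp.pos k)]
  · intro q _
    exact Nat.ordProj_mul_ordCompl_eq_self q p
  · intros; rfl

/-- The partial sums of the Ramanujan series over the moduli prime to `p`. -/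
noncomputable def coprimePartial (G : ArithmeticFunction ℂ) (p b x : ℕ) : ℂ :=
  ∑ q ∈ (Finset.Icc 1 x).filter (fun q => ¬ p ∣ q), G q * (ramanujanSum q b : ℂ)

theorem ramanujanPartial_prime_pow_mul {G : ArithmeticFunction ℂ} (hG : IsMult G) {p : ℕ}
    (hp : p.Prime) {b : ℕ} (hb : ¬ p ∣ b) (v x : ℕ) :
    ramanujanPartial G (p ^ v * b) x = ∑ k ∈ Finset.range (v + 1), (p : ℂ) ^ k *
      (G (p ^ k) * coprimePartial G p b (x / p ^ k)
        - G (p ^ (k + 1)) * coprimePartial G p b (x / p ^ (k + 1))) := by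
  set A : ℕ → ℂ := fun k => G (p ^ k) * coprimePartial G p b (x / p ^ k) with hA
  set h : ℕ → ℂ := fun k => if k ≤ v then (p : ℂ) ^ k else 0 with hh
  have hdvd (k : ℕ) : p ^ k ∣ p ^ v * b ↔ k ≤ v := by
    rw [((hp.coprime_iff_not_dvd.2 hb).pow_left k).dvd_mul_right]
    exact Nat.pow_dvd_pow_iff_le_right hp.one_lt
  have hc (k : ℕ) : (ramanujanSum (p ^ (k + 1)) (p ^ v * b) : ℂ) = h (k + 1) - h k := by
    rw [ramanujanSum_prime_pow_succ hp]
    simp only [hdvd, hh]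
    split_ifs <;> simp
  have hfib (k : ℕ) : ∑ m ∈ (Finset.Icc 1 (x / p ^ k)).filter (fun m => ¬ p ∣ m),
      G (p ^ k * m) * (ramanujanSum (p ^ k * m) (p ^ v * b) : ℂ)
      = (ramanujanSum (p ^ k) (p ^ v * b) : ℂ) * A k := by
    simp only [hA, coprimePartial, Finset.mul_sum]
    refine Finset.sum_congr rfl fun m hm => ?_
    have hpm : p.Coprime m := hp.coprime_iff_not_dvd.2 (Finset.mem_filter.1 hm).2
    rw [hG _ _ (hpm.pow_left k), ramanujanSum_mul (hpm.pow_left k),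
      ramanujanSum_mul_right (q := m) (hpm.symm.pow_right v)]
    push_cast; ring
  -- The cutoff exceeds `x`, so that all moduli are covered, and `v`, so that the boundary term `h
  -- (x + v + 1)` of the Abel summation vanishes.
  rw [ramanujanPartial, sum_Icc_eq_sum_prime_pow_mul hp (show x < x + v + 1 + 1 by omega)]
  simp only [hfib]
  rw [Finset.sum_range_succ', pow_zero, ramanujanSum_one_left]
  simp only [hc]
  have h0 : h 0 = 1 := by simp [hh]
  have hN : h (x + v + 1) = 0 := if_neg (by omega)
  have key : ∑ k ∈ Finset.range (x + v + 1), h (k + 1) * A (k + 1) + h 0 * A 0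
      = ∑ k ∈ Finset.range (x + v + 1), h k * A k := by
    rw [← Finset.sum_range_succ' (fun k => h k * A k), Finset.sum_range_succ, hN]; simp
  rw [h0] at key
  have hsub : ∑ k ∈ Finset.range (v + 1), (p : ℂ) ^ k * (A k - A (k + 1))
      = ∑ k ∈ Finset.range (x + v + 1), h k * (A k - A (k + 1)) := by
    rw [← Finset.sum_subset (Finset.range_mono (show v + 1 ≤ x + v + 1 by omega))]
    · refine Finset.sum_congr rfl fun k hk => ?_
      rw [hh]
      simp only
      rw [if_pos (Nat.lt_succ_iff.1 (Finset.mem_range.1 hk))]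
    · intro k _ hk
      have : h k = 0 := if_neg (by simpa using hk)
      rw [this, zero_mul]
  change _ = ∑ k ∈ Finset.range (v + 1), (p : ℂ) ^ k * (A k - A (k + 1))
  rw [hsub]
  simp only [sub_mul, mul_sub, Finset.sum_sub_distrib]
  push_cast
  rw [← key]; ring

theorem exists_tendsto_coprimePartial_sub {G : ArithmeticFunction ℂ} (hG : IsMult G)
    (hR : IsRamanujanCoefficient G) {p : ℕ} (hp : p.Prime) {b : ℕ} (hb : ¬ p ∣ b) :
    ∃ l : ℕ → ℂ,
      (∀ v, ramanujanSeries G (p ^ v * b) = ∑ k ∈ Finset.range (v + 1), (p : ℂ) ^ k * l k) ∧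
      ∀ k, Tendsto (fun x => G (p ^ k) * coprimePartial G p b x
        - G (p ^ (k + 1)) * coprimePartial G p b (x / p)) atTop (𝓝 (l k)) := by
  have hb0 : b ≠ 0 := by rintro rfl; exact hb (dvd_zero p)
  have hpc : (p : ℂ) ≠ 0 := Nat.cast_ne_zero.2 hp.ne_zero
  have hS (v : ℕ) := tendsto_ramanujanPartial hR (mul_ne_zero (pow_ne_zero v hp.ne_zero) hb0)
  set D : ℕ → ℕ → ℂ := fun k x => G (p ^ k) * coprimePartial G p b (x / p ^ k)
        - G (p ^ (k + 1)) * coprimePartial G p b (x / p ^ (k + 1)) with hD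
  have hPart (v x : ℕ) : ramanujanPartial G (p ^ v * b) x
      = ∑ k ∈ Finset.range (v + 1), (p : ℂ) ^ k * D k x :=
    ramanujanPartial_prime_pow_mul hG hp hb v x
  have hDlim (k : ℕ) : ∃ l, Tendsto (D k) atTop (𝓝 l) := by
    cases k with
    | zero =>
      refine ⟨_, (hS 0).congr fun x => ?_⟩
      rw [hPart]; simp
    | succ k =>
      -- The bracket is isolated by subtracting the partial sums at consecutive powers of `p`.
      refine ⟨_, (((hS (k + 1)).sub (hS k)).const_mul (((p : ℂ) ^ (k + 1))⁻¹)).congr fun x => ?_⟩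
      rw [hPart, hPart, Finset.sum_range_succ _ (k + 1), add_sub_cancel_left,
        inv_mul_cancel_left₀ (pow_ne_zero _ hpc)]
  choose l hl using hDlim
  refine ⟨l, fun v => ?_, fun k => ?_⟩
  · refine tendsto_nhds_unique (hS v) ?_
    simp_rw [funext (hPart v)]
    exact tendsto_finsetSum _ fun k _ => (hl k).const_mul _
  · have hk : 0 < p ^ k := pow_pos hp.pos _
    -- Along the subsequence `p ^ k * x` the floor divisions by `p ^ k` become exact.
    refine ((hl k).comp (tendsto_id.const_mul_atTop' hk)).congr fun x => ?_
    simp only [hD, Function.comp_apply, id]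
    rw [Nat.mul_div_cancel_left _ hk, pow_succ, Nat.mul_div_mul_left _ _ hk]

theorem ramanujanSeries_prime_pow_mul_of_forall_eq {G : ArithmeticFunction ℂ} (hG : IsMult G)
    (hR : IsRamanujanCoefficient G) {p : ℕ} (hp : p.Prime) {b : ℕ} (hb : ¬ p ∣ b)
    (h : ∀ k, G (p ^ k) = G p ^ k) (v : ℕ) :
    ramanujanSeries G (p ^ v * b)
      = ramanujanSeries G b * ∑ k ∈ Finset.range (v + 1), (p : ℂ) ^ k * G p ^ k := by
  obtain ⟨l, hl, hlim⟩ := exists_tendsto_coprimePartial_sub hG hR hp hb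
  have hlk (k : ℕ) : l k = G p ^ k * l 0 := by
    refine tendsto_nhds_unique (hlim k) (((hlim 0).const_mul (G p ^ k)).congr fun x => ?_)
    simp only [h]; ring
  have h0 := hl 0
  simp only [pow_zero, one_mul, zero_add, Finset.sum_range_one] at h0
  rw [hl v, h0, Finset.mul_sum]
  refine Finset.sum_congr rfl fun k _ => ?_
  rw [hlk]; ring

theorem exists_ramanujanSeries_prime_pow_mul {G : ArithmeticFunction ℂ} (hG : IsMult G)
    (h1 : G 1 = 1) (hR : IsRamanujanCoefficient G) {p : ℕ} (hp : p.Prime) {b : ℕ} (hb : ¬ p ∣ b)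
    (h : ¬ ∀ k, G (p ^ k) = G p ^ k) :
    ∃ t : ℂ, ∀ v, ramanujanSeries G (p ^ v * b)
      = t * ∑ k ∈ Finset.range (v + 1), (p : ℂ) ^ k * (G (p ^ k) - G (p ^ (k + 1))) := by
  obtain ⟨l, hl, hlim⟩ := exists_tendsto_coprimePartial_sub hG hR hp hb
  -- This says that brackets `0` and `k` have nonzero determinant; if no such `k` existed, induction
  -- would give `G(p^k) = G(p)^k` throughout.
  obtain ⟨k, hk⟩ : ∃ k, G (p ^ (k + 1)) ≠ G (p ^ k) * G p := by
    by_contra! hcon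
    refine h fun k => ?_
    induction k with
    | zero => simpa using h1
    | succ k ih => rw [hcon, ih, pow_succ]
  have hk' := sub_ne_zero.2 hk
  have hT : Tendsto (fun x => coprimePartial G p b (x / p)) atTop
      (𝓝 ((G (p ^ (k + 1)) - G (p ^ k) * G p)⁻¹ * (G (p ^ k) * l 0 - l k))) := by
    -- Eliminating `C(x)` from brackets `0` and `k` leaves the determinant times `C(x/p)`.
    refine ((((hlim 0).const_mul (G (p ^ k))).sub (hlim k)).const_mul _).congr fun x => ?_
    rw [inv_mul_eq_iff_eq_mul₀ hk']
    simp only [pow_zero, h1, zero_add, pow_one]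
    ring
  set t := (G (p ^ (k + 1)) - G (p ^ k) * G p)⁻¹ * (G (p ^ k) * l 0 - l k)
  have hT' : Tendsto (coprimePartial G p b) atTop (𝓝 t) := by
    refine (hT.comp (tendsto_id.const_mul_atTop' hp.pos)).congr fun x => ?_
    simp [Nat.mul_div_cancel_left _ hp.pos]
  refine ⟨t, fun v => ?_⟩
  rw [hl v, Finset.mul_sum]
  refine Finset.sum_congr rfl fun j _ => ?_
  rw [tendsto_nhds_unique (hlim j) ((hT'.const_mul _).sub (hT.const_mul _))]
  ring

/-! ### Transparency indices and local Euler factors -/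

variable {G : ArithmeticFunction ℂ} {p : ℕ}

theorem IsMult.map_one (hG : IsMult G) (h : G ≠ 0) : G 1 = 1 := by
  obtain ⟨n, hn⟩ : ∃ n, G n ≠ 0 := by
    by_contra! h'
    exact h (ArithmeticFunction.ext h')
  have := hG n 1 (Nat.coprime_one_right n)
  rw [mul_one] at this
  exact (mul_eq_left₀ hn).1 this.symm

theorem transparencyIndex_eq_top_iff : transparencyIndex G p = ⊤ ↔ ∀ k, G (p ^ (k + 1)) = 1 := by
  simp [transparencyIndex, iInf_eq_top]

theorem exists_transparencyIndex_eq (h : transparencyIndex G p ≠ ⊤) :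
    ∃ n : ℕ, transparencyIndex G p = n ∧ G (p ^ (n + 1)) ≠ 1 ∧ ∀ k < n, G (p ^ (k + 1)) = 1 := by
  classical
  rw [Ne, transparencyIndex_eq_top_iff] at h
  push Not at h
  refine ⟨Nat.find h, le_antisymm (iInf₂_le_of_le (Nat.find h) (Nat.find_spec h) le_rfl) (le_iInf₂ fun K hK => ?_),
    Nat.find_spec h, fun k hk => not_not.1 (Nat.find_min h hk)⟩
  exact Nat.cast_le.2 (Nat.find_min' h hK)

theorem transparencyIndex_eq_zero_iff : transparencyIndex G p = 0 ↔ G p ≠ 1 := by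
  refine ⟨fun h => ?_, fun h => ?_⟩
  · obtain ⟨n, hn, hn1, -⟩ := exists_transparencyIndex_eq (G := G) (p := p) (by simp [h])
    have : n = 0 := by rw [h] at hn; exact_mod_cast hn.symm
    simpa [this] using hn1
  · exact nonpos_iff_eq_zero.1 (iInf₂_le (α := ℕ∞) 0 (by simpa using h))

/-- When `G p = 1`, both indices measure the initial run of ones among the `G (p ^ k)`, `k ≥ 1`. -/
theorem cmIndex_eq_transparencyIndex (h : G p = 1) : cmIndex G p = transparencyIndex G p := by
  refine le_antisymm (iSup₂_le fun w hw => le_iInf₂ fun K hK => ?_) ?_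
  · refine Nat.cast_le.2 (not_lt.1 fun hlt => hK ?_)
    rw [hw.2 (K + 1) (by omega) hlt, h, one_pow]
  by_cases ht : transparencyIndex G p = ⊤
  · rw [ht]
    have h1 := transparencyIndex_eq_top_iff.1 ht
    refine ENat.forall_natCast_le_iff_le.1 fun m _ => ?_
    refine le_trans (Nat.cast_le.2 (Nat.le_succ m)) (le_iSup₂_of_le (m + 1) ⟨by omega, ?_⟩ le_rfl)
    intro k hk _
    obtain ⟨j, rfl⟩ := Nat.exists_eq_add_of_le' hk
    rw [h1, h, one_pow]
  · obtain ⟨n, hn, hn1, hn2⟩ := exists_transparencyIndex_eq ht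
    rw [hn]
    refine le_iSup₂_of_le n ⟨Nat.pos_of_ne_zero ?_, ?_⟩ le_rfl
    · rintro rfl
      exact hn1 (by simpa using h)
    · intro k hk hkn
      obtain ⟨j, rfl⟩ := Nat.exists_eq_add_of_le' hk
      rw [hn2 j (by omega), h, one_pow]

open Classical in
/-- The local factor of the Ramanujan series at `p`, whatever the transparency index. -/
noncomputable def eulerFactor (G : ArithmeticFunction ℂ) (p v : ℕ) : ℂ :=
  if transparencyIndex G p = ⊤ then hyperFactor p v else finiteFactor G p v

theorem finiteFactor_eq (hp : p ≠ 0) {n : ℕ} (hn : transparencyIndex G p = n) (v : ℕ) :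
    finiteFactor G p v = ((p : ℂ) ^ n * (1 - G (p ^ (n + 1))))⁻¹ *
      ∑ k ∈ Finset.range (v + 1), (p : ℂ) ^ k * (G (p ^ k) - G (p ^ (k + 1))) := by
  rw [finiteFactor, hn, ENat.toNat_natCast, Finset.mul_sum]
  refine Finset.sum_congr rfl fun k _ => ?_
  rw [zpow_sub₀ (Nat.cast_ne_zero.2 hp), zpow_natCast, zpow_natCast, mul_inv]
  ring

theorem map_prime_pow_eq_one (h1 : G 1 = 1) {n : ℕ} (hn : ∀ k < n, G (p ^ (k + 1)) = 1) {k : ℕ}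
    (hk : k ≤ n) : G (p ^ k) = 1 := by
  cases k with
  | zero => simpa using h1
  | succ k => exact hn k hk

theorem sum_range_eq_zero_of_forall_eq_one (h1 : G 1 = 1) {n : ℕ}
    (hn : ∀ k < n, G (p ^ (k + 1)) = 1) {v : ℕ} (hv : v ≤ n) :
    ∑ k ∈ Finset.range v, (p : ℂ) ^ k * (G (p ^ k) - G (p ^ (k + 1))) = 0 := by
  refine Finset.sum_eq_zero fun k hk => ?_
  have hk := Finset.mem_range.1 hk
  rw [map_prime_pow_eq_one h1 hn (k := k) (by omega), hn k (by omega), sub_self, mul_zero]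

theorem finiteFactor_add (hp : p ≠ 0) (h1 : G 1 = 1) {n : ℕ} (hn : transparencyIndex G p = n)
    (hn2 : ∀ k < n, G (p ^ (k + 1)) = 1) (K : ℕ) :
    finiteFactor G p (n + K) = (1 - G (p ^ (n + 1)))⁻¹ *
      ∑ k ∈ Finset.range (K + 1), (p : ℂ) ^ k * (G (p ^ (n + k)) - G (p ^ (n + k + 1))) := by
  have hpn : (p : ℂ) ^ n ≠ 0 := pow_ne_zero _ (Nat.cast_ne_zero.2 hp)
  rw [finiteFactor_eq hp hn, add_assoc, Finset.sum_range_add,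
    sum_range_eq_zero_of_forall_eq_one h1 hn2 le_rfl, zero_add]
  simp only [pow_add (p : ℂ) n, mul_assoc]
  rw [← Finset.mul_sum, mul_inv]
  field_simp

/-- The normalisation that makes `N_T` the base point. For an infinite index `toNat` is `0`, where
`hyperFactor` is the single term `1`. -/
theorem eulerFactor_transparencyIndex (hp : p ≠ 0) (h1 : G 1 = 1) :
    eulerFactor G p (transparencyIndex G p).toNat = 1 := by
  rw [eulerFactor]
  split_ifs with h
  · simp [h, hyperFactor]
  · obtain ⟨n, hn, hn1, hn2⟩ := exists_transparencyIndex_eq h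
    have := finiteFactor_add hp h1 hn hn2 0
    rw [hn, ENat.toNat_natCast, ← add_zero n, this]
    simp only [zero_add, Finset.sum_range_one, pow_zero, one_mul, add_zero]
    rw [map_prime_pow_eq_one h1 hn2 le_rfl, inv_mul_cancel₀ (sub_ne_zero.2 hn1.symm)]

/-- Below the index all differences `G(p^k) - G(p^(k+1))` are `1 - 1`; this is why `R_G` lives on
multiples of `N_T`. -/
theorem eulerFactor_eq_zero (hp : p ≠ 0) (h1 : G 1 = 1) {v : ℕ}
    (hv : v < (transparencyIndex G p).toNat) : eulerFactor G p v = 0 := by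
  rw [eulerFactor]
  split_ifs with h
  · simp [h] at hv
  · obtain ⟨n, hn, -, hn2⟩ := exists_transparencyIndex_eq h
    rw [hn, ENat.toNat_natCast] at hv
    rw [finiteFactor_eq hp hn, sum_range_eq_zero_of_forall_eq_one h1 hn2 hv, mul_zero]

theorem ramanujanSeries_prime_pow_mul (hG : IsMult G) (h1 : G 1 = 1)
    (hR : IsRamanujanCoefficient G) (hp : p.Prime) {b : ℕ} (hb : ¬ p ∣ b) (v : ℕ) :
    ramanujanSeries G (p ^ v * b)
      = ramanujanSeries G (p ^ (transparencyIndex G p).toNat * b) * eulerFactor G p v := by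
  rw [eulerFactor]
  split_ifs with h
  · have h' := transparencyIndex_eq_top_iff.1 h
    have hp1 : G p = 1 := by simpa using h' 0
    have hk (k : ℕ) : G (p ^ k) = G p ^ k := by
      cases k with
      | zero => simpa using h1
      | succ k => rw [h', hp1, one_pow]
    rw [ramanujanSeries_prime_pow_mul_of_forall_eq hG hR hp hb hk]
    simp [h, hp1, hyperFactor]
  · obtain ⟨n, hn, hn1, hn2⟩ := exists_transparencyIndex_eq h
    have hne : 1 - G (p ^ (n + 1)) ≠ 0 := sub_ne_zero.2 hn1.symm
    rw [finiteFactor_eq hp.ne_zero hn, hn, ENat.toNat_natCast]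
    by_cases hk : ∀ k, G (p ^ k) = G p ^ k
    -- A positive finite index would force `G p = 1`, and then complete multiplicativity along
    -- powers of `p` would make the index infinite.
    · obtain rfl : n = 0 := by
        by_contra hn0
        have : G p = 1 := by simpa using hn2 0 (Nat.pos_of_ne_zero hn0)
        exact hn1 (by rw [hk, this, one_pow])
      rw [ramanujanSeries_prime_pow_mul_of_forall_eq hG hR hp hb hk]
      simp only [pow_zero, one_mul, zero_add, pow_one] at hne ⊢
      congr 1
      rw [Finset.mul_sum]
      refine Finset.sum_congr rfl fun k _ => ?_
      rw [hk, hk, pow_succ]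
      field_simp
    · obtain ⟨t, ht⟩ := exists_ramanujanSeries_prime_pow_mul hG h1 hR hp hb hk
      rw [ht, ht, Finset.sum_range_succ _ n, sum_range_eq_zero_of_forall_eq_one h1 hn2 le_rfl,
        map_prime_pow_eq_one h1 hn2 le_rfl, zero_add]
      have hpn : (p : ℂ) ^ n ≠ 0 := pow_ne_zero _ (Nat.cast_ne_zero.2 hp.ne_zero)
      field_simp

/-! ### Finiteness of the transparent primes and the conductor -/

/-- The terms of the convergent series at `a = 1` tend to zero, and `c_p(1) = -1`. -/
theorem finite_prime_one_le_norm (hR : IsRamanujanCoefficient G) :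
    {p : ℕ | p.Prime ∧ 1 ≤ ‖G p‖}.Finite := by
  have hS := tendsto_ramanujanPartial hR one_ne_zero
  have hdiff : Tendsto (fun x => G (x + 1) * (ramanujanSum (x + 1) 1 : ℂ)) atTop (𝓝 0) := by
    have := ((tendsto_add_atTop_iff_nat 1).2 hS).sub hS
    rw [sub_self] at this
    refine this.congr fun x => ?_
    rw [ramanujanPartial, ramanujanPartial, Finset.sum_Icc_succ_top (by omega),
      add_sub_cancel_left]
  have hev := hdiff.norm.eventually (gt_mem_nhds (show ‖(0 : ℂ)‖ < 1 by simp))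
  obtain ⟨X, hX⟩ := eventually_atTop.1 hev
  refine (Set.finite_Iio (X + 1)).subset fun p hp => ?_
  by_contra hlt
  obtain ⟨x, rfl⟩ := Nat.exists_eq_add_of_le' hp.1.one_le
  have hx := hX x (by simpa using hlt)
  have hc := ramanujanSum_prime_pow_succ hp.1 0 1
  have hnd : ¬ (x + 1 = 1) := hp.1.one_lt.ne'
  rw [zero_add, pow_one] at hc
  rw [hc, if_neg (by simpa using hnd)] at hx
  norm_num at hx
  exact absurd hx (not_lt.2 hp.2)

theorem finite_isTransparentPrime (hR : IsRamanujanCoefficient G) :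
    {p : ℕ | IsTransparentPrime G p}.Finite :=
  (finite_prime_one_le_norm hR).subset fun p hp => ⟨hp.1, by simp [hp.2]⟩

theorem factorization_prod_pow (S : Finset ℕ) (hS : ∀ p ∈ S, p.Prime) (α : ℕ → ℕ) (q : ℕ) :
    (∏ p ∈ S, p ^ α p).factorization q = if q ∈ S then α q else 0 := by
  rw [Nat.factorization_prod fun p hp => pow_ne_zero _ (hS p hp).ne_zero, Finsupp.finsetSum_apply,
    ← Finset.sum_ite_eq' S q α]
  refine Finset.sum_congr rfl fun p hp => ?_
  rw [(hS p hp).factorization_pow, Finsupp.single_apply]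

/-- Hypertransparent primes may be included in the product: their exponent is `toNat ⊤ = 0`. -/
theorem transparencyConductor_eq (hR : IsRamanujanCoefficient G) :
    transparencyConductor G = ∏ p ∈ (finite_isTransparentPrime hR).toFinset,
      p ^ (transparencyIndex G p).toNat := by
  have hbad : {p : ℕ | IsBadPrime G p}.Finite :=
    (finite_prime_one_le_norm hR).subset fun p hp => ⟨hp.1, hp.2.1⟩
  rw [transparencyConductor, if_pos hbad]
  have hs : {p : ℕ | IsSimplyTransparent G p}.Finite :=
    (finite_isTransparentPrime hR).subset fun p hp => hp.1
  change ∏ᶠ p ∈ {p : ℕ | IsSimplyTransparent G p}, _ = _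
  rw [finprod_mem_eq_finite_toFinset_prod _ hs]
  rw [Finset.prod_congr rfl fun p hp => by
    rw [cmIndex_eq_transparencyIndex (hs.mem_toFinset.1 hp).1.2]]
  refine Finset.prod_subset ?_ ?_
  · intro p hp
    simp only [Set.Finite.mem_toFinset, Set.mem_ofPred_eq] at hp ⊢
    exact hp.1
  · intro p hp hp'
    simp only [Set.Finite.mem_toFinset, Set.mem_ofPred_eq, IsSimplyTransparent, not_and, not_not]
      at hp hp'
    rw [← cmIndex_eq_transparencyIndex hp.2, hp' hp]
    simp

theorem transparencyConductor_pos (hR : IsRamanujanCoefficient G) :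
    0 < transparencyConductor G := by
  rw [transparencyConductor_eq hR]
  refine Finset.prod_pos fun p hp => pow_pos ?_ _
  exact ((finite_isTransparentPrime hR).mem_toFinset.1 hp).1.pos

theorem factorization_transparencyConductor (hR : IsRamanujanCoefficient G) (hp : p.Prime) :
    (transparencyConductor G).factorization p = (transparencyIndex G p).toNat := by
  rw [transparencyConductor_eq hR, factorization_prod_pow]
  · split_ifs with h
    · rfl
    · have : G p ≠ 1 := fun h' => h ((finite_isTransparentPrime hR).mem_toFinset.2 ⟨hp, h'⟩)
      simp [transparencyIndex_eq_zero_iff.2 this]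
  · exact fun q hq => ((finite_isTransparentPrime hR).mem_toFinset.1 hq).1

/-! ### The global Euler product -/

/-- Exponents are normalised one prime at a time. The free cofactor `m` lets the induction absorb
the power of the prime just treated. -/
theorem ramanujanSeries_mul_prod_pow (hG : IsMult G) (h1 : G 1 = 1)
    (hR : IsRamanujanCoefficient G) (α : ℕ → ℕ) (S : Finset ℕ) :
    (∀ p ∈ S, p.Prime) → ∀ m : ℕ, (∀ p ∈ S, ¬ p ∣ m) →
    ramanujanSeries G (m * ∏ p ∈ S, p ^ α p)
      = ramanujanSeries G (m * ∏ p ∈ S, p ^ (transparencyIndex G p).toNat)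
        * ∏ p ∈ S, eulerFactor G p (α p) := by
  induction S using Finset.induction_on with
  | empty => simp
  | insert q S hq ih =>
    intro hS m hm
    have hqp := hS q (Finset.mem_insert_self q S)
    have hS' : ∀ p ∈ S, p.Prime := fun p hp => hS p (Finset.mem_insert_of_mem hp)
    have hprod : ¬ q ∣ m * ∏ p ∈ S, p ^ α p := by
      rw [hqp.dvd_mul, not_or]
      refine ⟨hm q (Finset.mem_insert_self q S), fun h => ?_⟩
      obtain ⟨r, hr, hqr⟩ := (hqp.prime.dvd_finsetProd_iff _).1 h
      have := (Nat.prime_dvd_prime_iff_eq hqp (hS' r hr)).1 (hqp.dvd_of_dvd_pow hqr)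
      exact hq (this ▸ hr)
    have hm' : ∀ p ∈ S, ¬ p ∣ m * q ^ (transparencyIndex G q).toNat := by
      intro p hp h
      rcases (hS' p hp).dvd_mul.1 h with h | h
      · exact hm p (Finset.mem_insert_of_mem hp) h
      · have := (Nat.prime_dvd_prime_iff_eq (hS' p hp) hqp).1 ((hS' p hp).dvd_of_dvd_pow h)
        exact hq (this ▸ hp)
    have e1 : m * (q ^ α q * ∏ p ∈ S, p ^ α p) = q ^ α q * (m * ∏ p ∈ S, p ^ α p) := by ring
    rw [Finset.prod_insert hq, Finset.prod_insert hq, Finset.prod_insert hq, e1,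
      ramanujanSeries_prime_pow_mul hG h1 hR hqp hprod, mul_left_comm, ← mul_assoc m,
      ih hS' _ hm', mul_assoc, mul_comm (∏ p ∈ S, eulerFactor G p (α p)),
      mul_assoc m]

theorem prod_pow_factorization_eq {a : ℕ} (ha : a ≠ 0) {S : Finset ℕ} (hS : a.primeFactors ⊆ S) :
    ∏ p ∈ S, p ^ a.factorization p = a := by
  conv_rhs => rw [← Nat.prod_factorization_pow_eq_self ha]
  exact (Finsupp.prod_of_support_subset _ (by simpa using hS) _ (by simp)).symm

theorem ramanujanSeries_eq_mul_prod (hG : IsMult G) (h1 : G 1 = 1)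
    (hR : IsRamanujanCoefficient G) {a : ℕ} (ha : a ≠ 0) {S : Finset ℕ} (hS : ∀ p ∈ S, p.Prime)
    (haS : a.primeFactors ⊆ S) (hNS : (transparencyConductor G).primeFactors ⊆ S) :
    ramanujanSeries G a = ramanujanSeries G (transparencyConductor G)
      * ∏ p ∈ S, eulerFactor G p (a.factorization p) := by
  have := ramanujanSeries_mul_prod_pow hG h1 hR (fun p => a.factorization p) S hS 1
    (fun p hp => (hS p hp).not_dvd_one)
  have hN : ∏ p ∈ S, p ^ (transparencyIndex G p).toNat = transparencyConductor G := by
    refine Eq.trans ?_ (prod_pow_factorization_eq (transparencyConductor_pos hR).ne' hNS)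
    exact Finset.prod_congr rfl fun p hp => by
      rw [factorization_transparencyConductor hR (hS p hp)]
  rwa [one_mul, one_mul, hN, prod_pow_factorization_eq ha haS] at this

theorem finite_transparencyIndex_or_factorization (hR : IsRamanujanCoefficient G) {a : ℕ}
    (ha : a ≠ 0) :
    {p : ℕ | p.Prime ∧ ¬ (transparencyIndex G p = 0 ∧ a.factorization p = 0)}.Finite := by
  refine ((finite_isTransparentPrime hR).union a.primeFactors.finite_toSet).subset ?_
  rintro p ⟨hp, h⟩
  by_cases h1 : G p = 1
  · exact Or.inl ⟨hp, h1⟩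
  · refine Or.inr (Nat.mem_primeFactors.2 ⟨hp, ?_, ha⟩)
    by_contra hd
    exact h ⟨transparencyIndex_eq_zero_iff.2 h1, Nat.factorization_eq_zero_of_not_dvd hd⟩

theorem eulerFactor_zero (hp : p ≠ 0) (h1 : G 1 = 1) (h : transparencyIndex G p = 0) :
    eulerFactor G p 0 = 1 := by
  simpa [h] using eulerFactor_transparencyIndex hp h1

theorem exists_finset_ramanujanSeries_eq (hG : IsMult G) (h1 : G 1 = 1)
    (hR : IsRamanujanCoefficient G) {a : ℕ} (ha : a ≠ 0) :
    ∃ S : Finset ℕ, (∀ p ∈ S, p.Prime) ∧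
      (∀ p, p.Prime → p ∉ S → eulerFactor G p (a.factorization p) = 1) ∧
      ramanujanSeries G a = ramanujanSeries G (transparencyConductor G)
        * ∏ p ∈ S, eulerFactor G p (a.factorization p) := by
  have hfin := finite_transparencyIndex_or_factorization hR ha
  have hS : ∀ p ∈ hfin.toFinset, p.Prime := fun p hp => (hfin.mem_toFinset.1 hp).1
  refine ⟨hfin.toFinset, hS, fun p hp hpS => ?_,
    ramanujanSeries_eq_mul_prod hG h1 hR ha hS ?_ ?_⟩
  · have : transparencyIndex G p = 0 ∧ a.factorization p = 0 := by
      by_contra h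
      exact hpS (hfin.mem_toFinset.2 ⟨hp, h⟩)
    rw [this.2, eulerFactor_zero hp.ne_zero h1 this.1]
  · intro p hp
    refine hfin.mem_toFinset.2 ⟨Nat.prime_of_mem_primeFactors hp, fun h => ?_⟩
    exact (Finsupp.mem_support_iff.1 (by simpa using hp)) h.2
  · intro p hp
    have hpp := Nat.prime_of_mem_primeFactors hp
    refine hfin.mem_toFinset.2 ⟨hpp, fun h => ?_⟩
    have h0 := factorization_transparencyConductor hR hpp
    rw [h.1] at h0
    exact (Finsupp.mem_support_iff.1 (by simpa using hp)) h0

theorem finprod_primes_eq_prod {f : ℕ → ℂ} {S : Finset ℕ} (hS : ∀ p ∈ S, p.Prime)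
    (h : ∀ p, p.Prime → p ∉ S → f p = 1) : ∏ᶠ p : Nat.Primes, f p = ∏ p ∈ S, f p := by
  rw [← Finset.prod_subtype_of_mem f hS]
  refine finprod_eq_prod_of_mulSupport_subset _ fun p hp => ?_
  by_contra hpS
  exact hp (h p p.2 fun hmem => hpS (Finset.mem_coe.2 (Finset.mem_subtype.2 hmem)))

theorem finprod_prime_and_eq_prod {f : ℕ → ℂ} {S : Finset ℕ} (P : ℕ → Prop) [DecidablePred P]
    (hS : ∀ p ∈ S, p.Prime) (h : ∀ p, p.Prime → P p → p ∉ S → f p = 1) :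
    ∏ᶠ (p : ℕ) (_ : p.Prime ∧ P p), f p = ∏ p ∈ S with P p, f p := by
  refine finprod_mem_eq_prod_of_inter_mulSupport_eq (s := {p | p.Prime ∧ P p}) f ?_
  ext p
  simp only [Set.mem_inter_iff, Set.mem_ofPred_eq, Function.mem_mulSupport, Finset.coe_filter]
  refine ⟨fun ⟨⟨hp, hP⟩, hf⟩ => ⟨⟨?_, hP⟩, hf⟩, fun ⟨⟨hp, hP⟩, hf⟩ => ⟨⟨hS p hp, hP⟩, hf⟩⟩
  by_contra hpS
  exact hf (h p hp hP hpS)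

theorem ramanujanSeries_eq_mul_finprod (hG : IsMult G) (h1 : G 1 = 1)
    (hR : IsRamanujanCoefficient G) {a : ℕ} (ha : a ≠ 0) :
    ramanujanSeries G a = ramanujanSeries G (transparencyConductor G)
      * ∏ᶠ p : Nat.Primes, eulerFactor G p (a.factorization p) := by
  obtain ⟨S, hS, hS1, h⟩ := exists_finset_ramanujanSeries_eq hG h1 hR ha
  rw [h, finprod_primes_eq_prod (f := fun p => eulerFactor G p (a.factorization p)) hS hS1]

theorem ramanujanSeries_eq_mul_finprod_mul_finprod (hG : IsMult G) (h1 : G 1 = 1)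
    (hR : IsRamanujanCoefficient G) {a : ℕ} (ha : a ≠ 0) :
    ramanujanSeries G a = ramanujanSeries G (transparencyConductor G) *
        (∏ᶠ (p : ℕ) (_ : p.Prime ∧ transparencyIndex G p = ⊤),
          hyperFactor p (a.factorization p)) *
        (∏ᶠ (p : ℕ) (_ : p.Prime ∧ transparencyIndex G p ≠ ⊤),
          finiteFactor G p (a.factorization p)) := by
  classical
  obtain ⟨S, hS, hS1, h⟩ := exists_finset_ramanujanSeries_eq hG h1 hR ha
  rw [finprod_prime_and_eq_prod (f := fun p => hyperFactor p (a.factorization p))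
      (fun p => transparencyIndex G p = ⊤) hS,
    finprod_prime_and_eq_prod (f := fun p => finiteFactor G p (a.factorization p))
      (fun p => transparencyIndex G p ≠ ⊤) hS, h, mul_assoc, ← Finset.prod_ite]
  · congr 1
  · intro p hp ht hpS
    rw [← hS1 p hp hpS, eulerFactor, if_neg ht]
  · intro p hp ht hpS
    rw [← hS1 p hp hpS, eulerFactor, if_pos ht]

theorem finite_eulerFactor_ne_one (h1 : G 1 = 1) (hR : IsRamanujanCoefficient G) {a : ℕ}
    (ha : a ≠ 0) : {p : ℕ | p.Prime ∧ eulerFactor G p (a.factorization p) ≠ 1}.Finite := by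
  refine (finite_transparencyIndex_or_factorization hR ha).subset fun p hp => ⟨hp.1, fun h => ?_⟩
  exact hp.2 (by rw [h.2, eulerFactor_zero hp.1.ne_zero h1 h.1])

theorem ramanujanSeries_eq_zero (hG : IsMult G) (h1 : G 1 = 1) (hR : IsRamanujanCoefficient G)
    {a : ℕ} (ha : ¬ transparencyConductor G ∣ a) : ramanujanSeries G a = 0 := by
  have ha0 : a ≠ 0 := by rintro rfl; exact ha (dvd_zero _)
  obtain ⟨S, hS, hS1, h⟩ := exists_finset_ramanujanSeries_eq hG h1 hR ha0
  rw [← (Nat.factorization_prime_le_iff_dvd (transparencyConductor_pos hR).ne' ha0)] at ha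
  push Not at ha
  obtain ⟨p, hp, hlt⟩ := ha
  rw [factorization_transparencyConductor hR hp] at hlt
  have h0 := eulerFactor_eq_zero hp.ne_zero h1 hlt
  -- Outside `S` the factors are `1`, so the vanishing factor must occur inside.
  have hpS : p ∈ S := by
    by_contra hpS
    exact one_ne_zero ((hS1 p hp hpS).symm.trans h0)
  rw [h, Finset.prod_eq_zero hpS h0, mul_zero]

/-! ### The multiplicative function `M_G` and its values -/

/-- The multiplicative function `M_G`. -/
noncomputable def reducedSeries (G : ArithmeticFunction ℂ) : ArithmeticFunction ℂ :=
  ⟨fun n => if n = 0 then 0 else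
    ∏ p ∈ n.primeFactors, eulerFactor G p ((transparencyIndex G p).toNat + n.factorization p),
    by simp⟩

theorem reducedSeries_apply {n : ℕ} (hn : n ≠ 0) : reducedSeries G n =
    ∏ p ∈ n.primeFactors, eulerFactor G p ((transparencyIndex G p).toNat + n.factorization p) :=
  if_neg hn

theorem isMult_reducedSeries (G : ArithmeticFunction ℂ) : IsMult (reducedSeries G) := by
  intro m n h
  rcases eq_or_ne m 0 with rfl | hm
  · simp
  rcases eq_or_ne n 0 with rfl | hn
  · simp
  rw [reducedSeries_apply hm, reducedSeries_apply hn, reducedSeries_apply (mul_ne_zero hm hn),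
    Nat.primeFactors_mul hm hn, Finset.prod_union h.disjoint_primeFactors]
  congr 1
  · refine Finset.prod_congr rfl fun p hp => ?_
    rw [Nat.factorization_eq_of_coprime_left h (Nat.mem_primeFactors_iff_mem_primeFactorsList.1 hp)]
  · refine Finset.prod_congr rfl fun p hp => ?_
    rw [Nat.factorization_eq_of_coprime_right h (Nat.mem_primeFactors_iff_mem_primeFactorsList.1 hp)]

theorem reducedSeries_prime_pow (h1 : G 1 = 1) (hp : p.Prime) (K : ℕ) :
    reducedSeries G (p ^ K) = eulerFactor G p ((transparencyIndex G p).toNat + K) := by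
  rw [reducedSeries_apply (pow_ne_zero _ hp.ne_zero)]
  rcases eq_or_ne K 0 with rfl | hK
  · simp [eulerFactor_transparencyIndex hp.ne_zero h1]
  · simp [Nat.primeFactors_prime_pow hK hp, hp.factorization_pow]

theorem reducedSeries_eq_prod (h1 : G 1 = 1) {a : ℕ} (ha : a ≠ 0) :
    reducedSeries G a = ∏ p ∈ a.primeFactors, reducedSeries G (p ^ a.factorization p) := by
  rw [reducedSeries_apply ha]
  exact Finset.prod_congr rfl fun p hp =>
    (reducedSeries_prime_pow h1 (Nat.prime_of_mem_primeFactors hp) _).symm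

theorem ramanujanSeries_mul_transparencyConductor (hG : IsMult G) (h1 : G 1 = 1)
    (hR : IsRamanujanCoefficient G) {a : ℕ} (ha : a ≠ 0) :
    ramanujanSeries G (a * transparencyConductor G)
      = ramanujanSeries G (transparencyConductor G) * reducedSeries G a := by
  have hN := (transparencyConductor_pos hR).ne'
  have hS : ∀ p ∈ (a * transparencyConductor G).primeFactors, p.Prime :=
    fun p => Nat.prime_of_mem_primeFactors
  rw [ramanujanSeries_eq_mul_prod hG h1 hR (mul_ne_zero ha hN) hS subset_rfl
    (Nat.primeFactors_mono (dvd_mul_left _ _) (mul_ne_zero ha hN)), reducedSeries_apply ha]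
  have hfac : ∀ p ∈ (a * transparencyConductor G).primeFactors,
      (a * transparencyConductor G).factorization p
        = (transparencyIndex G p).toNat + a.factorization p := fun p hp => by
    rw [Nat.factorization_mul ha hN, Finsupp.add_apply,
      factorization_transparencyConductor hR (hS p hp), add_comm]
  rw [Finset.prod_congr rfl fun p hp => by rw [hfac p hp]]
  congr 1
  refine (Finset.prod_subset (Nat.primeFactors_mono (dvd_mul_right _ _) (mul_ne_zero ha hN))
    fun p hp hpa => ?_).symm
  have hnd : ¬ p ∣ a := fun h => hpa (Nat.mem_primeFactors.2 ⟨hS p hp, h, ha⟩)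
  rw [Nat.factorization_eq_zero_of_not_dvd hnd, add_zero,
    eulerFactor_transparencyIndex (hS p hp).ne_zero h1]

theorem IsHypertransparent.transparencyIndex_eq (h : IsHypertransparent G p) :
    transparencyIndex G p = ⊤ := by
  rw [← cmIndex_eq_transparencyIndex h.1.2, h.2]

theorem IsSimplyTransparent.transparencyIndex_ne (h : IsSimplyTransparent G p) :
    transparencyIndex G p ≠ ⊤ := by
  rw [← cmIndex_eq_transparencyIndex h.1.2]
  exact h.2

theorem reducedSeries_prime_pow_of_isHypertransparent (h1 : G 1 = 1) (h : IsHypertransparent G p)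
    (K : ℕ) : reducedSeries G (p ^ K) = ∑ k ∈ Finset.range (K + 1), (p : ℂ) ^ k := by
  rw [reducedSeries_prime_pow h1 h.1.1, eulerFactor, if_pos h.transparencyIndex_eq,
    h.transparencyIndex_eq, ENat.toNat_top, zero_add, hyperFactor]

theorem reducedSeries_prime_pow_of_ne_top (h1 : G 1 = 1) (hp : p.Prime)
    (h : transparencyIndex G p ≠ ⊤) (K : ℕ) :
    reducedSeries G (p ^ K) = (1 - G (p ^ ((transparencyIndex G p).toNat + 1)))⁻¹ *
      ∑ k ∈ Finset.range (K + 1), (p : ℂ) ^ k *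
        (G (p ^ ((transparencyIndex G p).toNat + k))
          - G (p ^ ((transparencyIndex G p).toNat + k + 1))) := by
  obtain ⟨n, hn, -, hn2⟩ := exists_transparencyIndex_eq h
  rw [reducedSeries_prime_pow h1 hp, eulerFactor, if_neg h, hn, ENat.toNat_natCast,
    finiteFactor_add hp.ne_zero h1 hn hn2]

theorem reducedSeries_prime_pow_of_not_transparent (h1 : G 1 = 1) (hp : p.Prime)
    (hh : ¬ IsHypertransparent G p) (hs : ¬ IsSimplyTransparent G p) (K : ℕ) :
    reducedSeries G (p ^ K) = (1 - G p)⁻¹ *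
      ∑ k ∈ Finset.range (K + 1), (p : ℂ) ^ k * (G (p ^ k) - G (p ^ (k + 1))) := by
  have hne : G p ≠ 1 := fun h => by
    by_cases hc : cmIndex G p = ⊤
    · exact hh ⟨⟨hp, h⟩, hc⟩
    · exact hs ⟨⟨hp, h⟩, hc⟩
  have h0 := transparencyIndex_eq_zero_iff.2 hne
  rw [reducedSeries_prime_pow_of_ne_top h1 hp (by simp [h0])]
  simp [h0]

/-- Identifies the quotients in the final product formula with the Euler factors, since only the
exponent of `p` in `N_T` is altered. -/
theorem ramanujanSeries_replace_factorization (hG : IsMult G) (h1 : G 1 = 1)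
    (hR : IsRamanujanCoefficient G) (hp : p.Prime) (v : ℕ) :
    ramanujanSeries G (transparencyConductor G
        / p ^ (transparencyConductor G).factorization p * p ^ v)
      = ramanujanSeries G (transparencyConductor G) * eulerFactor G p v := by
  have hN := (transparencyConductor_pos hR).ne'
  rw [mul_comm, ramanujanSeries_prime_pow_mul hG h1 hR hp (Nat.not_dvd_ordCompl hp hN),
    ← factorization_transparencyConductor hR hp, Nat.ordProj_mul_ordCompl_eq_self]

/-! ### Selberg- and semi-multiplicativity -/

/-- The constant is absorbed into the factor at the prime `2`, which costs at most one more
exception to `f p 0 = 1`. -/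
theorem isSelbergMultiplicative_of_eq_mul_finprod {F : ArithmeticFunction ℂ} (c : ℂ)
    (f : Nat.Primes → ℕ → ℂ) (hf : {p | f p 0 ≠ 1}.Finite)
    (hfa : ∀ a : ℕ, a ≠ 0 → {p : Nat.Primes | f p (a.factorization p) ≠ 1}.Finite)
    (hF : ∀ a : ℕ, a ≠ 0 → F a = c * ∏ᶠ p : Nat.Primes, f p (a.factorization p)) :
    IsSelbergMultiplicative F := by
  classical
  let two : Nat.Primes := ⟨2, Nat.prime_two⟩
  have hsupp : (Function.mulSupport fun p : Nat.Primes => if p = two then c else 1) ⊆ {two} := by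
    intro p hp
    by_contra h
    exact hp (if_neg h)
  refine ⟨fun p v => (if p = two then c else 1) * f p v, ?_, fun a ha => ?_⟩
  · refine (hf.union (Set.finite_singleton two)).subset fun p hp => ?_
    by_contra h
    simp only [Set.mem_union, Set.mem_singleton_iff, not_or, Set.mem_ofPred_eq, not_not] at h
    exact hp (by simp only [h.1, if_neg h.2, one_mul])
  · rw [finprod_mul_distrib ((Set.finite_singleton two).subset hsupp) (hfa a ha), hF a ha,
      finprod_eq_single _ two fun p hp => if_neg hp, if_pos rfl]

theorem finite_primes_eulerFactor_ne_one (h1 : G 1 = 1) (hR : IsRamanujanCoefficient G) {a : ℕ}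
    (ha : a ≠ 0) : {p : Nat.Primes | eulerFactor G p (a.factorization p) ≠ 1}.Finite := by
  refine Set.Finite.of_finite_image
    ((finite_eulerFactor_ne_one h1 hR ha).subset ?_) Nat.Primes.coe_nat_injective.injOn
  rintro _ ⟨p, hp, rfl⟩
  exact ⟨p.2, hp⟩

theorem isSelbergMultiplicative_ramanujanSeries (hG : IsMult G) (h1 : G 1 = 1)
    (hR : IsRamanujanCoefficient G) : IsSelbergMultiplicative (ramanujanSeries G) := by
  refine isSelbergMultiplicative_of_eq_mul_finprod _ (fun p v => eulerFactor G p v) ?_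
    (fun a ha => finite_primes_eulerFactor_ne_one h1 hR ha)
    fun a ha => ramanujanSeries_eq_mul_finprod hG h1 hR ha
  simpa using finite_primes_eulerFactor_ne_one h1 hR one_ne_zero

theorem ramanujanSeries_eq_zero_of_conductor (hG : IsMult G) (h1 : G 1 = 1)
    (hR : IsRamanujanCoefficient G) (h : ramanujanSeries G (transparencyConductor G) = 0) :
    ramanujanSeries G = 0 := by
  ext a
  rcases eq_or_ne a 0 with rfl | ha
  · simp
  · rw [ramanujanSeries_eq_mul_finprod hG h1 hR ha, h, zero_mul, ArithmeticFunction.zero_apply]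

theorem isSemiMultiplicative_zero : IsSemiMultiplicative 0 :=
  ⟨1, 1, 0, one_ne_zero, one_pos, fun m n _ => by simp, fun n _ => by simp⟩

theorem isSelbergMultiplicative_zero : IsSelbergMultiplicative 0 :=
  isSelbergMultiplicative_of_eq_mul_finprod 0 (fun _ _ => 1) (by simp) (fun _ _ => by simp)
    (fun _ _ => by simp)

theorem isSemiMultiplicative_ramanujanSeries (hG : IsMult G) (h1 : G 1 = 1)
    (hR : IsRamanujanCoefficient G) : IsSemiMultiplicative (ramanujanSeries G) := by
  by_cases h : ramanujanSeries G (transparencyConductor G) = 0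
  · rw [ramanujanSeries_eq_zero_of_conductor hG h1 hR h]
    exact isSemiMultiplicative_zero
  · refine ⟨_, transparencyConductor G, reducedSeries G, h, transparencyConductor_pos hR,
      isMult_reducedSeries G, fun n hn => ?_⟩
    split_ifs with hd
    · obtain ⟨a, rfl⟩ := hd
      rw [Nat.mul_div_cancel_left _ (transparencyConductor_pos hR), mul_comm,
        ramanujanSeries_mul_transparencyConductor hG h1 hR (right_ne_zero_of_mul hn)]
    · exact ramanujanSeries_eq_zero hG h1 hR hd

/-! ### The null coefficient -/

theorem ramanujanSeries_zero : ramanujanSeries 0 = 0 := by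
  ext a
  have hP (a : ℕ) : ramanujanPartial 0 a = fun _ => 0 := by
    ext x
    simp [ramanujanPartial]
  have hR : IsRamanujanCoefficient 0 := fun a _ => ⟨0, by rw [hP]; exact tendsto_const_nhds⟩
  rcases eq_or_ne a 0 with rfl | ha
  · simp
  · have := tendsto_ramanujanPartial hR ha
    rw [hP] at this
    simpa using tendsto_nhds_unique this tendsto_const_nhds

theorem transparencyConductor_zero (hR : IsRamanujanCoefficient 0) :
    transparencyConductor 0 = 1 := by
  rw [transparencyConductor_eq hR]
  refine Finset.prod_eq_one fun p hp => ?_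
  simpa using ((finite_isTransparentPrime hR).mem_toFinset.1 hp).2

end RamanujanExpansion

theorem corollary1p2 (G : ArithmeticFunction ℂ) (hG : IsMult G)
    (hR : IsRamanujanCoefficient G) :
    -- the transparency conductor is a genuine natural number, and `R_G` lives on its multiples
    0 < transparencyConductor G ∧
    (∀ a : ℕ, ¬ transparencyConductor G ∣ a → ramanujanSeries G a = 0) ∧
    -- the multiplicative function `M_G`, its explicit values and its uniqueness
    (∃ M : ArithmeticFunction ℂ, IsMult M ∧
      (∀ a : ℕ, a ≠ 0 →
        ramanujanSeries G (a * transparencyConductor G)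
            = ramanujanSeries G (transparencyConductor G) * M a ∧
        ramanujanSeries G (a * transparencyConductor G)
            = ramanujanSeries G (transparencyConductor G) *
              ∏ p ∈ a.primeFactors, M (p ^ a.factorization p)) ∧
      (∀ p K : ℕ, p.Prime →
        (IsHypertransparent G p →
          M (p ^ K) = ∑ k ∈ Finset.range (K + 1), (p : ℂ) ^ k) ∧
        (IsSimplyTransparent G p →
          M (p ^ K) = (1 - G (p ^ ((transparencyIndex G p).toNat + 1)))⁻¹ *
            ∑ k ∈ Finset.range (K + 1), (p : ℂ) ^ k *
              (G (p ^ ((transparencyIndex G p).toNat + k))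
                - G (p ^ ((transparencyIndex G p).toNat + k + 1)))) ∧
        (¬ IsHypertransparent G p → ¬ IsSimplyTransparent G p →
          M (p ^ K) = (1 - G p)⁻¹ *
            ∑ k ∈ Finset.range (K + 1), (p : ℂ) ^ k * (G (p ^ k) - G (p ^ (k + 1))))) ∧
      (ramanujanSeries G (transparencyConductor G) ≠ 0 →
        ∀ M' : ArithmeticFunction ℂ,
          (∀ a : ℕ, a ≠ 0 → ramanujanSeries G (a * transparencyConductor G)
            = ramanujanSeries G (transparencyConductor G) * M' a) → M' = M)) ∧
    (ramanujanSeries G (transparencyConductor G) = 0 → ramanujanSeries G = 0) ∧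
    -- the explicit Euler product
    (∀ a : ℕ, a ≠ 0 →
      ramanujanSeries G a = ramanujanSeries G (transparencyConductor G) *
        (∏ᶠ (p : ℕ) (_ : p.Prime ∧ transparencyIndex G p = ⊤),
          hyperFactor p (a.factorization p)) *
        (∏ᶠ (p : ℕ) (_ : p.Prime ∧ transparencyIndex G p ≠ ⊤),
          finiteFactor G p (a.factorization p))) ∧
    -- finiteness of the products
    (∀ a : ℕ, a ≠ 0 →
      {p : ℕ | p.Prime ∧ ¬ (transparencyIndex G p = 0 ∧ a.factorization p = 0)}.Finite ∧
      (G ≠ 0 →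
        {p : ℕ | (p.Prime ∧ transparencyIndex G p = ⊤) ∧
          hyperFactor p (a.factorization p) ≠ 1}.Finite ∧
        {p : ℕ | (p.Prime ∧ transparencyIndex G p ≠ ⊤) ∧
          finiteFactor G p (a.factorization p) ≠ 1}.Finite)) ∧
    -- semi-multiplicativity, the threshold and the Selberg factorization
    IsSemiMultiplicative (ramanujanSeries G) ∧
    IsSelbergMultiplicative (ramanujanSeries G) ∧
    (ramanujanSeries G (transparencyConductor G) ≠ 0 →
      IsLeast {n : ℕ | ramanujanSeries G n ≠ 0} (transparencyConductor G) ∧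
      ∀ a : ℕ, a ≠ 0 →
        {p : Nat.Primes |
          ramanujanSeries G (transparencyConductor G
            / (p : ℕ) ^ (transparencyConductor G).factorization p * (p : ℕ) ^ a.factorization p)
            / ramanujanSeries G (transparencyConductor G) ≠ 1}.Finite ∧
        ramanujanSeries G a = ramanujanSeries G (transparencyConductor G) *
          ∏ᶠ p : Nat.Primes,
            ramanujanSeries G (transparencyConductor G
              / (p : ℕ) ^ (transparencyConductor G).factorization p * (p : ℕ) ^ a.factorization p)
              / ramanujanSeries G (transparencyConductor G)) := by
  -- The null function is the one multiplicative `G` with `G 1 ≠ 1`, so the Euler product is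
  -- unavailable. It has no transparent prime, and `M = 0` satisfies all the formulas.
  rcases eq_or_ne G 0 with rfl | hG0
  · have hN := transparencyConductor_zero hR
    have hh (p : ℕ) : ¬ IsHypertransparent 0 p := fun h => by simpa using h.1.2
    have hs (p : ℕ) : ¬ IsSimplyTransparent 0 p := fun h => by simpa using h.1.2
    refine ⟨transparencyConductor_pos hR, by simp [ramanujanSeries_zero],
      ⟨0, fun m n _ => by simp, by simp [ramanujanSeries_zero],
        fun p K _ => ⟨fun h => absurd h (hh p), fun h => absurd h (hs p), by simp⟩,
        by simp [ramanujanSeries_zero]⟩,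
      fun _ => ramanujanSeries_zero, by simp [ramanujanSeries_zero],
      fun a ha => ⟨finite_transparencyIndex_or_factorization hR ha, fun h => absurd rfl h⟩, ?_, ?_,
      by simp [ramanujanSeries_zero]⟩
    · rw [ramanujanSeries_zero]; exact isSemiMultiplicative_zero
    · rw [ramanujanSeries_zero]; exact isSelbergMultiplicative_zero
  have h1 := hG.map_one hG0
  have hNpos := transparencyConductor_pos hR
  refine ⟨hNpos, fun a ha => ramanujanSeries_eq_zero hG h1 hR ha,
    ⟨reducedSeries G, isMult_reducedSeries G, fun a ha => ?_, fun p K hp => ⟨fun h => ?_,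
      fun h => ?_, fun hh hs => ?_⟩, fun hne M' hM' => ?_⟩,
    ramanujanSeries_eq_zero_of_conductor hG h1 hR,
    fun a ha => ramanujanSeries_eq_mul_finprod_mul_finprod hG h1 hR ha,
    fun a ha => ⟨finite_transparencyIndex_or_factorization hR ha, fun _ => ⟨?_, ?_⟩⟩,
    isSemiMultiplicative_ramanujanSeries hG h1 hR,
    isSelbergMultiplicative_ramanujanSeries hG h1 hR, fun hne => ⟨⟨hne, fun n hn => ?_⟩,
      fun a ha => ?_⟩⟩
  · rw [← reducedSeries_eq_prod h1 ha]
    exact ⟨ramanujanSeries_mul_transparencyConductor hG h1 hR ha,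
      ramanujanSeries_mul_transparencyConductor hG h1 hR ha⟩
  · exact reducedSeries_prime_pow_of_isHypertransparent h1 h K
  · exact reducedSeries_prime_pow_of_ne_top h1 hp h.transparencyIndex_ne K
  · exact reducedSeries_prime_pow_of_not_transparent h1 hp hh hs K
  · ext a
    rcases eq_or_ne a 0 with rfl | ha
    · simp
    · refine mul_left_cancel₀ hne ?_
      rw [← hM' a ha, ramanujanSeries_mul_transparencyConductor hG h1 hR ha]
  · refine (finite_eulerFactor_ne_one h1 hR ha).subset fun p hp => ⟨hp.1.1, ?_⟩
    rw [eulerFactor, if_pos hp.1.2]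
    exact hp.2
  · refine (finite_eulerFactor_ne_one h1 hR ha).subset fun p hp => ⟨hp.1.1, ?_⟩
    rw [eulerFactor, if_neg hp.1.2]
    exact hp.2
  · have hn0 : n ≠ 0 := by rintro rfl; exact hn (by simp)
    refine Nat.le_of_dvd (Nat.pos_of_ne_zero hn0) ?_
    by_contra hd
    exact hn (ramanujanSeries_eq_zero hG h1 hR hd)
  · simp only [fun p : Nat.Primes => ramanujanSeries_replace_factorization hG h1 hR p.2,
      mul_div_cancel_left₀ _ hne]
    exact ⟨finite_primes_eulerFactor_ne_one h1 hR ha,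
      ramanujanSeries_eq_mul_finprod hG h1 hR ha⟩
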